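/- Let $k \ge 3$ and $n \ge 3k\binom{2k}{k}$ be integers, and let $\mathcal{F}$ be a family of $k$-element subsets of $[n]=\{1,\dots,n\}$. Suppose that $\mathcal{F}$ is $(3,2k)$-conditionally intersecting, that is, $\mathcal{F}$ does not contain three different sets $A_1,A_2,A_3$ with $|A_1\cup A_2\cup A_3|\le 2k$ and $A_1\cap A_2\cap A_3=\emptyset$. Suppose also that $\mathcal{F}$ is not intersecting, that is, $\mathcal{F}$ contains two disjoint sets. Then $$|\mathcal{F}|\le \binom{n-k-1}{k-1}+1.$$ -/

import Mathlib

/-- A family `F` of subsets of `α` is `(d, s)`-conditionally intersecting if it does not contain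
`d` different sets whose union has at most `s` elements and whose intersection is empty. -/
def IsConditionallyIntersecting {α : Type*} [Fintype α] [DecidableEq α] (d s : ℕ)
    (F : Finset (Finset α)) : Prop :=
  ¬ ∃ G : Finset (Finset α), G ⊆ F ∧ G.card = d ∧ (G.sup id).card ≤ s ∧ G.inf id = ∅

namespace ConditionallyIntersecting
open Finset

variable {V : Type*} [Fintype V] [DecidableEq V]

/-! Write n = |V| and suppose that |F| exceeds the bound. If x ∈ A is not an own point of A, another
member B contains A \ {x}; for every further member C through x, the union A ∪ B ∪ C has at most 2k
points, so A meets C outside x (`exists_ne_mem_inter`). By pigeonhole, a point that is unowned in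
many members is dominated (`exists_dominates`).

Fix one dominator for each dominated point. Apart from few exceptions, a member has two own points,
or a single own point c that is the dominator of all its other points. There are at most C(n, k-1)
pairs (member, own point), and |F| is nearly that large, so a single c is the dominator of almost
all points (`two_mul_card_le`, `exists_center`). A second count leaves at most 2k other points
(`card_nondominated_le`). A member avoiding c lies among these, so there are at most C(2k, k) of
them.

As F is not intersecting, some member B avoids c. Members through c that meet B exclude at least
twice as many k-sets through c disjoint from B (`two_mul_card_meeting_le`), and a second member
avoiding c costs more than all such members contribute (`card_le_of_card_avoiding_le`). -/

/-! ### Own points and domination -/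

/-- The points `x` of `A` such that `A \ {x}` lies in no member of `F` other than `A`. -/
def ownPoints (F : Finset (Finset V)) (A : Finset V) : Finset V :=
  {x ∈ A | ∀ B ∈ F, A.erase x ⊆ B → B = A}

/-- The members of `F` that contain `z`, but not as an own point. -/
def unownedAt (F : Finset (Finset V)) (z : V) : Finset (Finset V) :=
  {A ∈ F | z ∈ A ∧ z ∉ ownPoints F A}

/-- Every member of `F` through `z` passes through the further point `y`. -/
def Dominates (F : Finset (Finset V)) (y z : V) : Prop :=
  y ≠ z ∧ ∀ C ∈ F, z ∈ C → y ∈ C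

lemma mem_ownPoints {F : Finset (Finset V)} {A : Finset V} {x : V} :
    x ∈ ownPoints F A ↔ x ∈ A ∧ ∀ B ∈ F, A.erase x ⊆ B → B = A := by
  simp [ownPoints]

lemma mem_unownedAt {F : Finset (Finset V)} {A : Finset V} {z : V} :
    A ∈ unownedAt F z ↔ A ∈ F ∧ z ∈ A ∧ z ∉ ownPoints F A := by
  simp [unownedAt]

/-- A member containing A \ {y} contains z, so domination puts y back into it. -/
lemma Dominates.mem_ownPoints {F : Finset (Finset V)} {y z : V} (h : Dominates F y z) {k : ℕ}
    (hF : ∀ A ∈ F, A.card = k) {A : Finset V} (hA : A ∈ F) (hz : z ∈ A) :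
    y ∈ ownPoints F A := by
  refine ConditionallyIntersecting.mem_ownPoints.2 ⟨h.2 A hA hz, fun B hB hAB => ?_⟩
  have hzB : z ∈ B := hAB (mem_erase.2 ⟨h.1.symm, hz⟩)
  have : A ⊆ B := by
    intro a ha
    by_cases hay : a = y
    · exact hay ▸ h.2 B hB hzB
    · exact hAB (mem_erase.2 ⟨hay, ha⟩)
  exact (eq_of_subset_of_card_le this (by rw [hF A hA, hF B hB])).symm

/-- Three members with union of size at most `s` have a common point. -/
lemma exists_mem_inter {F : Finset (Finset V)} {s : ℕ} (h : IsConditionallyIntersecting 3 s F)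
    {A B C : Finset V} (hA : A ∈ F) (hB : B ∈ F) (hC : C ∈ F) (hAB : A ≠ B) (hAC : A ≠ C)
    (hBC : B ≠ C) (hs : (A ∪ B ∪ C).card ≤ s) : ∃ x, x ∈ A ∧ x ∈ B ∧ x ∈ C := by
  by_contra hcon
  push Not at hcon
  refine h ⟨{A, B, C}, ?_, card_eq_three.2 ⟨A, B, C, hAB, hAC, hBC, rfl⟩, ?_, ?_⟩
  · intro X hX
    simp only [mem_insert, mem_singleton] at hX
    rcases hX with rfl | rfl | rfl <;> assumption
  · simpa [union_assoc] using hs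
  · ext x
    simp only [inf_insert, inf_singleton, id, inf_eq_inter, mem_inter, notMem_empty, iff_false]
    exact fun hx => hcon x hx.1 hx.2.1 hx.2.2

/-- Since x is unowned in A, some member B ⊇ A \ {x} omits x. Then |A ∪ B ∪ C| ≤ (k + 1) + (k - 1),
and the common point of A, B, C is not x because it lies in B. -/
lemma exists_ne_mem_inter {F : Finset (Finset V)} {k : ℕ} (hF : ∀ A ∈ F, A.card = k)
    (h : IsConditionallyIntersecting 3 (2 * k) F) {A C : Finset V} {x : V}
    (hA : A ∈ unownedAt F x) (hC : C ∈ F) (hxC : x ∈ C) (hAC : A ≠ C) :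
    ∃ y ∈ C, y ≠ x ∧ y ∈ A := by
  obtain ⟨hAF, hxA, hx⟩ := mem_unownedAt.1 hA
  have : ∃ B ∈ F, A.erase x ⊆ B ∧ B ≠ A := by
    by_contra hcon
    push Not at hcon
    exact hx (mem_ownPoints.2 ⟨hxA, hcon⟩)
  obtain ⟨B, hB, hAB, hBA⟩ := this
  have hxB : x ∉ B := by
    intro hxB
    have hsub : A ⊆ B := by
      rw [← insert_erase hxA]
      exact insert_subset hxB hAB
    exact hBA (eq_of_subset_of_card_le hsub (by rw [hF A hAF, hF B hB])).symm
  have hAcard := hF A hAF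
  have hBcard := hF B hB
  have hCcard := hF C hC
  have h1 : (A ∪ B ∪ C).card ≤ 2 * k := by
    have e : A ∪ B ∪ C = insert x B ∪ C.erase x := by
      ext a
      simp only [mem_union, mem_insert, mem_erase]
      constructor
      · rintro ((ha | ha) | ha)
        · by_cases hax : a = x
          · exact Or.inl (Or.inl hax)
          · exact Or.inl (Or.inr (hAB (mem_erase.2 ⟨hax, ha⟩)))
        · exact Or.inl (Or.inr ha)
        · by_cases hax : a = x
          · exact Or.inl (Or.inl hax)
          · exact Or.inr ⟨hax, ha⟩
      · rintro ((ha | ha) | ha)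
        · exact Or.inl (Or.inl (ha ▸ hxA))
        · exact Or.inl (Or.inr ha)
        · exact Or.inr ha.2
    have hk : 0 < k := hAcard ▸ card_pos.2 ⟨x, hxA⟩
    have h2 := card_union_le (insert x B) (C.erase x)
    rw [card_insert_of_notMem hxB, card_erase_of_mem hxC] at h2
    rw [e]
    omega
  obtain ⟨y, hyA, hyB, hyC⟩ := exists_mem_inter h hAF hB hC (Ne.symm hBA) hAC
    (fun e => hxB (e ▸ hxC)) h1
  exact ⟨y, hyC, fun e => hxB (e ▸ hyB), hyA⟩

lemma card_filter_superset_le {F : Finset (Finset V)} {k : ℕ} (hF : ∀ A ∈ F, A.card = k)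
    (S : Finset V) :
    #{A ∈ F | S ⊆ A} ≤ (Fintype.card V - #S).choose (k - #S) := by
  rw [← card_compl, ← card_powersetCard]
  refine card_le_card_of_injOn (fun A => A \ S) ?_ ?_
  · intro A hA
    rw [mem_coe, mem_filter] at hA
    rw [mem_coe, mem_powersetCard]
    refine ⟨fun a ha => by simpa using (mem_sdiff.1 ha).2, ?_⟩
    rw [card_sdiff_of_subset hA.2, hF A hA.1]
  · intro A hA B hB hAB
    rw [mem_coe, mem_filter] at hA hB
    simp only at hAB
    rw [← sdiff_union_of_subset hA.2, hAB, sdiff_union_of_subset hB.2]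

/-- A point that is not an own point of many members is dominated. -/
lemma exists_dominates {F : Finset (Finset V)} {k : ℕ} (hk : 2 ≤ k) (hF : ∀ A ∈ F, A.card = k)
    (h : IsConditionallyIntersecting 3 (2 * k) F) {z : V}
    (hz : (k - 1) ^ 2 * (Fintype.card V - 3).choose (k - 3) < #(unownedAt F z)) :
    ∃ y, Dominates F y z := by
  set t := (Fintype.card V - 3).choose (k - 3)
  obtain ⟨A₀, hA₀⟩ : (unownedAt F z).Nonempty := card_pos.1 (by omega)
  have hA₀' := mem_unownedAt.1 hA₀
  have hcover : unownedAt F z ⊆ (A₀.erase z).biUnion fun y => {A ∈ unownedAt F z | y ∈ A} := by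
    intro A hA
    have hA' := mem_unownedAt.1 hA
    simp only [mem_biUnion, mem_filter, mem_erase]
    by_cases e : A = A₀
    · obtain ⟨y, hy⟩ : (A₀.erase z).Nonempty := by
        rw [← card_pos, card_erase_of_mem hA₀'.2.1, hF _ hA₀'.1]
        omega
      exact ⟨y, mem_erase.1 hy, hA, e ▸ (mem_erase.1 hy).2⟩
    · obtain ⟨y, hy, hyz, hyA⟩ := exists_ne_mem_inter hF h hA hA₀'.1 hA₀'.2.1 e
      exact ⟨y, ⟨hyz, hy⟩, hA, hyA⟩
  -- Pigeonhole over the k - 1 points of A₀ other than z.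
  obtain ⟨y, hy, hycard⟩ : ∃ y ∈ A₀.erase z, (k - 1) * t < #{A ∈ unownedAt F z | y ∈ A} := by
    by_contra hcon
    push Not at hcon
    have h1 := (card_le_card hcover).trans (card_biUnion_le_card_mul _ _ _ hcon)
    rw [card_erase_of_mem hA₀'.2.1, hF _ hA₀'.1] at h1
    have : (k - 1) * ((k - 1) * t) = (k - 1) ^ 2 * t := by ring
    omega
  refine ⟨y, (mem_erase.1 hy).1, fun C hC hzC => ?_⟩
  by_contra hyC
  have hyz := (mem_erase.1 hy).1
  -- If C passes through z but not y, every set counted here contains z, y and a third point of C: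
  -- at most (k - 1) * t sets.
  have hsub : {A ∈ unownedAt F z | y ∈ A} ⊆
      (C.erase z).biUnion fun x => {A ∈ F | ({z, y, x} : Finset V) ⊆ A} := by
    intro A hA
    obtain ⟨hA, hyA⟩ := mem_filter.1 hA
    have hA' := mem_unownedAt.1 hA
    obtain ⟨x, hx, hxz, hxA⟩ := exists_ne_mem_inter hF h hA hC hzC (fun e => hyC (e ▸ hyA))
    refine mem_biUnion.2 ⟨x, mem_erase.2 ⟨hxz, hx⟩, ?_⟩
    refine mem_filter.2 ⟨hA'.1, ?_⟩
    intro a ha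
    simp only [mem_insert, mem_singleton] at ha
    rcases ha with rfl | rfl | rfl
    exacts [hA'.2.1, hyA, hxA]
  have hle := (card_le_card hsub).trans (card_biUnion_le_card_mul _ _ t ?_)
  · rw [card_erase_of_mem hzC, hF _ hC] at hle
    omega
  · intro x hx
    have hxy : y ≠ x := fun e => hyC (e ▸ (mem_erase.1 hx).2)
    have h3 : #({z, y, x} : Finset V) = 3 :=
      card_eq_three.2 ⟨z, y, x, hyz.symm, (mem_erase.1 hx).1.symm, hxy, rfl⟩
    have := card_filter_superset_le hF ({z, y, x} : Finset V)
    rw [h3] at this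
    exact this

/-! ### Counting members by their own points -/

/-- Removing own points is injective on pairs of a member and an own point of it. -/
lemma sum_card_ownPoints_le {F : Finset (Finset V)} {k : ℕ} (hF : ∀ A ∈ F, A.card = k) :
    ∑ A ∈ F, #(ownPoints F A) ≤ (Fintype.card V).choose (k - 1) := by
  rw [← card_sigma, ← card_univ, ← card_powersetCard]
  refine card_le_card_of_injOn (fun p => p.1.erase p.2) ?_ ?_
  · rintro ⟨A, x⟩ hp
    rw [mem_coe, mem_sigma] at hp
    rw [mem_coe, mem_powersetCard]
    refine ⟨subset_univ _, ?_⟩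
    rw [card_erase_of_mem (mem_ownPoints.1 hp.2).1, hF A hp.1]
  · rintro ⟨A, x⟩ hp ⟨B, y⟩ hq hpq
    rw [mem_coe, mem_sigma] at hp hq
    simp only at hp hq hpq
    have hx := mem_ownPoints.1 hp.2
    have hy := mem_ownPoints.1 hq.2
    have e : B = A := hx.2 B hq.1 (hpq ▸ erase_subset _ _)
    subst e
    have : x = y := by
      by_contra hxy
      have : x ∈ B.erase y := mem_erase.2 ⟨hxy, hx.1⟩
      rw [← hpq] at this
      exact (mem_erase.1 this).1 rfl
    rw [this]

/-- The members with an own point other than their point `c` are few. -/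
lemma card_filter_ownPoints_ne_le {F : Finset (Finset V)} {k : ℕ} (hF : ∀ A ∈ F, A.card = k)
    (c : V) :
    #{A ∈ F | c ∈ A ∧ ∃ x ∈ ownPoints F A, x ≠ c} ≤
      (Fintype.card V - 1).choose (k - 2) := by
  have hex : ∀ A : Finset V, ∃ x, (∃ x ∈ ownPoints F A, x ≠ c) → x ∈ ownPoints F A ∧ x ≠ c := by
    intro A
    by_cases h : ∃ x ∈ ownPoints F A, x ≠ c
    · exact ⟨h.choose, fun _ => h.choose_spec⟩
    · exact ⟨c, fun h' => absurd h' h⟩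
  choose f hf using hex
  rw [← card_univ, ← card_erase_of_mem (mem_univ c), ← card_powersetCard]
  refine card_le_card_of_injOn (fun A => (A.erase (f A)).erase c) ?_ ?_
  · intro A hA
    rw [mem_coe, mem_filter] at hA
    obtain ⟨h1, h2⟩ := hf A hA.2.2
    rw [mem_coe, mem_powersetCard]
    refine ⟨erase_subset_erase _ (subset_univ _), ?_⟩
    rw [card_erase_of_mem (mem_erase.2 ⟨h2.symm, hA.2.1⟩),
      card_erase_of_mem (mem_ownPoints.1 h1).1, hF A hA.1]
    omega
  · intro A hA B hB hAB
    rw [mem_coe, mem_filter] at hA hB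
    obtain ⟨h1, h2⟩ := hf A hA.2.2
    simp only at hAB
    refine ((mem_ownPoints.1 h1).2 B hB.1 ?_).symm
    intro a ha
    by_cases hac : a = c
    · exact hac ▸ hB.2.1
    · have : a ∈ (A.erase (f A)).erase c := mem_erase.2 ⟨hac, ha⟩
      rw [hAB] at this
      exact (mem_erase.1 (mem_erase.1 this).2).2

/-- A choice of a dominating point for each dominated point; `none` for the other points. -/
structure IsDominator (F : Finset (Finset V)) (y : V → Option V) : Prop where
  dominates : ∀ z c, y z = some c → Dominates F c z
  eq_none : ∀ z, y z = none → ∀ c, ¬ Dominates F c z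

lemma exists_isDominator (F : Finset (Finset V)) : ∃ y, IsDominator F y := by
  have : ∀ z, ∃ o : Option V, (∀ c, o = some c → Dominates F c z) ∧
      (o = none → ∀ c, ¬ Dominates F c z) := by
    intro z
    by_cases h : ∃ c, Dominates F c z
    · obtain ⟨c, hc⟩ := h
      exact ⟨some c, by rintro _ ⟨⟩; exact hc, by rintro ⟨⟩⟩
    · exact ⟨none, by rintro _ ⟨⟩, fun _ c hc => h ⟨c, hc⟩⟩
  choose y hy using this
  exact ⟨y, fun z => (hy z).1, fun z => (hy z).2⟩

/-- The counting inequality behind the existence of a center. -/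
lemma two_mul_card_le {F : Finset (Finset V)} {k : ℕ} (hk : 2 ≤ k) (hF : ∀ A ∈ F, A.card = k)
    (h : IsConditionallyIntersecting 3 (2 * k) F) {y : V → Option V} (hy : IsDominator F y) :
    2 * #F ≤ (Fintype.card V).choose (k - 1) +
      2 * (#{z | y z = none} * ((k - 1) ^ 2 * (Fintype.card V - 3).choose (k - 3))) +
      ∑ c, (#{z | y z = some c}).choose (k - 1) := by
  set bad : Finset (Finset V) := ({z | y z = none} : Finset V).biUnion (unownedAt F)
  set good : Finset (Finset V) := (univ : Finset V).biUnion fun c =>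
    (powersetCard (k - 1) {z | y z = some c}).image (insert c)
  have hbad : #bad ≤ #{z | y z = none} * ((k - 1) ^ 2 * (Fintype.card V - 3).choose (k - 3)) := by
    refine card_biUnion_le_card_mul _ _ _ fun z hz => ?_
    by_contra hcon
    obtain ⟨c, hc⟩ := exists_dominates hk hF h (not_le.1 hcon)
    exact hy.eq_none z (mem_filter.1 hz).2 c hc
  have hgood : #good ≤ ∑ c, (#{z | y z = some c}).choose (k - 1) := by
    refine card_biUnion_le.trans (sum_le_sum fun c _ => ?_)
    exact card_image_le.trans (card_powersetCard _ _).le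
  have key : ∀ A ∈ F, 2 ≤ #(ownPoints F A) + 2 * (if A ∈ bad then 1 else 0) +
      (if A ∈ good then 1 else 0) := by
    intro A hA
    by_cases hAb : A ∈ bad
    · rw [if_pos hAb]
      exact (Nat.le_add_left 2 _).trans (Nat.le_add_right _ _)
    -- Outside `bad`, the chosen dominator of a non-own point of A is itself an own point of A. So a
    -- lone own point c is the dominator of all of A \ {c}.
    have hdom : ∀ z ∈ A, z ∉ ownPoints F A → ∃ c ∈ ownPoints F A, y z = some c := by
      intro z hz hzo
      cases hyz : y z with
      | none =>
        exact absurd (mem_biUnion.2 ⟨z, by simpa using hyz, mem_unownedAt.2 ⟨hA, hz, hzo⟩⟩) hAb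
      | some c => exact ⟨c, (hy.dominates z c hyz).mem_ownPoints hF hA hz, rfl⟩
    by_cases h2 : 2 ≤ #(ownPoints F A)
    · omega
    have h1 : #(ownPoints F A) = 1 := by
      have : 0 < #(ownPoints F A) := by
        obtain ⟨z, hz⟩ : A.Nonempty := card_pos.1 (by rw [hF A hA]; omega)
        by_cases hzo : z ∈ ownPoints F A
        · exact card_pos.2 ⟨z, hzo⟩
        · obtain ⟨c, hc, -⟩ := hdom z hz hzo
          exact card_pos.2 ⟨c, hc⟩
      omega
    obtain ⟨c, hc⟩ := card_eq_one.1 h1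
    have hcA : c ∈ A := (mem_ownPoints.1 (hc ▸ mem_singleton_self c)).1
    have hAg : A ∈ good := by
      refine mem_biUnion.2 ⟨c, mem_univ c, mem_image.2 ⟨A.erase c, ?_, insert_erase hcA⟩⟩
      refine mem_powersetCard.2 ⟨fun z hz => ?_, by rw [card_erase_of_mem hcA, hF A hA]⟩
      obtain ⟨hzc, hzA⟩ := mem_erase.1 hz
      obtain ⟨d, hd, hyd⟩ := hdom z hzA (by rw [hc]; simpa using hzc)
      rw [hc, mem_singleton] at hd
      simpa [hd] using hyd
    simp [h1, hAg]
  have hsum := sum_le_sum key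
  rw [sum_const, sum_add_distrib, sum_add_distrib, ← mul_sum, ← card_filter, ← card_filter,
    smul_eq_mul] at hsum
  have e1 : #{A ∈ F | A ∈ bad} ≤ #bad := card_le_card fun A hA => (mem_filter.1 hA).2
  have e2 : #{A ∈ F | A ∈ good} ≤ #good := card_le_card fun A hA => (mem_filter.1 hA).2
  have e3 := sum_card_ownPoints_le hF
  omega

/-- The members avoid the points dominated by `c`, or contain `c`. -/
lemma card_le_of_isDominator {F : Finset (Finset V)} {k : ℕ} (hk : 2 ≤ k)
    (hF : ∀ A ∈ F, A.card = k) (h : IsConditionallyIntersecting 3 (2 * k) F)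
    {y : V → Option V} (hy : IsDominator F y) (c : V) (W : Finset V)
    (hW : ∀ z, z ∈ W ↔ z ≠ c ∧ y z ≠ some c) :
    #F ≤ (#W).choose k + (#{z | y z = some c}).choose (k - 1) +
      (Fintype.card V - 1).choose (k - 2) +
      #W * ((k - 1) ^ 2 * (Fintype.card V - 3).choose (k - 3)) := by
  have hsub : F ⊆ powersetCard k W ∪
      (powersetCard (k - 1) {z | y z = some c}).image (insert c) ∪
      {A ∈ F | c ∈ A ∧ ∃ x ∈ ownPoints F A, x ≠ c} ∪
      ({z ∈ W | y z = none} : Finset V).biUnion (unownedAt F) := by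
    intro A hA
    simp only [mem_union]
    by_cases hcA : c ∈ A
    · by_cases ho : ∃ x ∈ ownPoints F A, x ≠ c
      · exact Or.inl (Or.inr (mem_filter.2 ⟨hA, hcA, ho⟩))
      push Not at ho
      -- No own point differs from c here. A point v ∈ W of A is thus unowned, and undominated,
      -- since its dominator would be an own point other than c.
      by_cases hv : ∃ v ∈ A, v ∈ W
      · obtain ⟨v, hvA, hvW⟩ := hv
        right
        obtain ⟨hvc, hyv⟩ := (hW v).1 hvW
        refine mem_biUnion.2 ⟨v, mem_filter.2 ⟨hvW, ?_⟩,
          mem_unownedAt.2 ⟨hA, hvA, fun hv => hvc (ho v hv)⟩⟩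
        cases hd : y v with
        | none => rfl
        | some d =>
          exact absurd (ho d ((hy.dominates v d hd).mem_ownPoints hF hA hvA))
            (fun e => hyv (e ▸ hd))
      · push Not at hv
        refine Or.inl (Or.inl (Or.inr (mem_image.2 ⟨A.erase c, ?_, insert_erase hcA⟩)))
        refine mem_powersetCard.2 ⟨fun z hz => ?_, by rw [card_erase_of_mem hcA, hF A hA]⟩
        obtain ⟨hzc, hzA⟩ := mem_erase.1 hz
        have := hv z hzA
        rw [hW] at this
        push Not at this
        simpa using this hzc
    · refine Or.inl (Or.inl (Or.inl (mem_powersetCard.2 ⟨fun z hz => ?_, hF A hA⟩)))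
      exact (hW z).2 ⟨fun e => hcA (e ▸ hz), fun e => hcA ((hy.dominates z c e).2 A hA hz)⟩
  have hb : #(({z ∈ W | y z = none} : Finset V).biUnion (unownedAt F)) ≤
      #W * ((k - 1) ^ 2 * (Fintype.card V - 3).choose (k - 3)) := by
    refine (card_biUnion_le_card_mul _ _ _ fun z hz => ?_).trans
      (Nat.mul_le_mul_right _ (card_filter_le _ _))
    by_contra hcon
    obtain ⟨d, hd⟩ := exists_dominates hk hF h (not_le.1 hcon)
    exact hy.eq_none z (mem_filter.1 hz).2 d hd
  have hi : #((powersetCard (k - 1) {z | y z = some c}).image (insert c)) ≤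
      (#{z | y z = some c}).choose (k - 1) := card_image_le.trans (card_powersetCard _ _).le
  have hp : #(powersetCard k W) = (#W).choose k := card_powersetCard _ _
  have ho := card_filter_ownPoints_ne_le hF c
  have := card_le_card hsub
  have u1 := card_union_le (powersetCard k W ∪
      (powersetCard (k - 1) {z | y z = some c}).image (insert c) ∪
      {A ∈ F | c ∈ A ∧ ∃ x ∈ ownPoints F A, x ≠ c})
      (({z ∈ W | y z = none} : Finset V).biUnion (unownedAt F))
  have u2 := card_union_le (powersetCard k W ∪
      (powersetCard (k - 1) {z | y z = some c}).image (insert c))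
      {A ∈ F | c ∈ A ∧ ∃ x ∈ ownPoints F A, x ≠ c}
  have u3 := card_union_le (powersetCard k W)
      ((powersetCard (k - 1) {z | y z = some c}).image (insert c))
  omega

/-! ### Sets excluded by a member that avoids the center -/

/-- The `k`-sets through `c` that are disjoint from `B` and do not belong to `F`. -/
def missing (F : Finset (Finset V)) (k : ℕ) (c : V) (B : Finset V) : Finset (Finset V) :=
  {A ∈ powersetCard k univ | c ∈ A ∧ Disjoint A B ∧ A ∉ F}

lemma succ_le_choose_add {m t : ℕ} (ht : 1 ≤ t) : m + 1 ≤ (m + t).choose t := by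
  rw [← Nat.choose_symm_add]
  calc m + 1 = (m + 1).choose m := by simp
    _ ≤ (m + t).choose m := Nat.choose_le_choose _ (by omega)

/-- Each member through `c` that meets `B` forces many sets through `c` to be missing. -/
lemma two_mul_card_meeting_le {F : Finset (Finset V)} {k : ℕ} (hF : ∀ A ∈ F, A.card = k)
    (h : IsConditionallyIntersecting 3 (2 * k) F)
    (hn : 2 * (2 * k).choose k + 2 * k ≤ Fintype.card V) {c : V} {B : Finset V} (hB : B ∈ F)
    (hc : c ∉ B) :
    2 * #{A ∈ F | c ∈ A ∧ ¬ Disjoint A B} ≤ #(missing F k c B) := by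
  have habove : ∀ A ∈ {A ∈ F | c ∈ A ∧ ¬ Disjoint A B}, 2 * (2 * k).choose k ≤
      #(bipartiteAbove (fun A A' => A \ B ⊆ A') (missing F k c B) A) := by
    intro A hA
    obtain ⟨hAF, hcA, hAB⟩ := mem_filter.1 hA
    have hAk := hF A hAF
    have hBk := hF B hB
    set t := #(A ∩ B) with ht
    have ht1 : 1 ≤ t := by
      rw [ht, Nat.one_le_iff_ne_zero, Ne, card_eq_zero, ← disjoint_iff_inter_eq_empty]
      exact hAB
    have hsd : #(A \ B) + t = k := by rw [card_sdiff_add_card_inter, hAk]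
    have hun : #(A ∪ B) + t = 2 * k := by rw [card_union_add_card_inter]; omega
    have hcompl : #(A ∪ B)ᶜ = (Fintype.card V - 2 * k) + t := by rw [card_compl]; omega
    -- Trade A ∩ B for any t points T outside A ∪ B. The new set is disjoint from B, and its union
    -- with A and B has 2k points, so it cannot lie in F.
    refine le_trans ?_ (card_le_card_of_injOn (s := powersetCard t (A ∪ B)ᶜ)
      (fun T => A \ B ∪ T) ?_ ?_)
    · rw [card_powersetCard, hcompl]
      have := succ_le_choose_add (m := Fintype.card V - 2 * k) ht1
      omega
    · intro T hT
      rw [mem_coe, mem_powersetCard] at hT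
      have hTd : ∀ a ∈ T, a ∉ A ∧ a ∉ B := fun a ha => by simpa using hT.1 ha
      have hcard : #(A \ B ∪ T) = k := by
        rw [card_union_of_disjoint, hT.2, hsd]
        exact disjoint_left.2 fun a ha haT => (hTd a haT).1 (mem_sdiff.1 ha).1
      have hdis : Disjoint (A \ B ∪ T) B := by
        refine disjoint_left.2 fun a ha haB => ?_
        rcases mem_union.1 ha with ha | ha
        exacts [(mem_sdiff.1 ha).2 haB, (hTd a ha).2 haB]
      have hcm : c ∈ A \ B ∪ T := mem_union_left _ (mem_sdiff.2 ⟨hcA, hc⟩)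
      rw [mem_coe, mem_bipartiteAbove]
      refine ⟨mem_filter.2 ⟨mem_powersetCard.2 ⟨subset_univ _, hcard⟩, hcm, hdis, fun hTF => ?_⟩,
        subset_union_left⟩
      obtain ⟨x, -, hx2, hx3⟩ := exists_mem_inter h hAF hTF hB
        (fun e => hAB (by rw [e]; exact hdis)) (fun e => hc (e ▸ hcA))
        (fun e => hc (by rw [← e]; exact hcm)) (by
          have e : A ∪ (A \ B ∪ T) ∪ B = (A ∪ B) ∪ T := by
            ext a
            simp only [mem_union, mem_sdiff]
            tauto
          rw [e]
          have := card_union_le (A ∪ B) T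
          omega)
      exact disjoint_left.1 hdis hx2 hx3
    · intro T hT T' hT' hTT
      rw [mem_coe, mem_powersetCard] at hT hT'
      simp only at hTT
      have aux : ∀ T : Finset V, T ⊆ (A ∪ B)ᶜ → (A \ B ∪ T) \ A = T := by
        intro T hT
        ext a
        have : a ∈ T → a ∉ A := fun ha => by
          have := hT ha
          simp only [compl_union, mem_inter, mem_compl] at this
          exact this.1
        simp only [mem_sdiff, mem_union]
        tauto
      rw [← aux T hT.1, hTT, aux T' hT'.1]
  -- If A \ B ⊆ A', then A is one of the k-subsets of the 2k-set A' ∪ B.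
  have hbelow : ∀ A' ∈ missing F k c B,
      #(bipartiteBelow (fun A A' => A \ B ⊆ A') {A ∈ F | c ∈ A ∧ ¬ Disjoint A B} A') ≤
        (2 * k).choose k := by
    intro A' hA'
    obtain ⟨hA'k, -, hd, -⟩ := mem_filter.1 hA'
    have hcard : #(A' ∪ B) = 2 * k := by
      rw [card_union_of_disjoint hd, (mem_powersetCard.1 hA'k).2, hF B hB]
      omega
    rw [← hcard, ← card_powersetCard]
    refine card_le_card fun A hA => ?_
    rw [mem_bipartiteBelow] at hA
    refine mem_powersetCard.2 ⟨fun a ha => ?_, hF A (mem_filter.1 hA.1).1⟩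
    by_cases haB : a ∈ B
    · exact mem_union_right _ haB
    · exact mem_union_left _ (hA.2 (mem_sdiff.2 ⟨ha, haB⟩))
  have hcount := card_mul_le_card_mul _ habove hbelow
  have hpos : 0 < (2 * k).choose k := Nat.choose_pos (by omega)
  refine Nat.le_of_mul_le_mul_right ?_ hpos
  linarith

/-- The number of `k`-sets that contain `S` and avoid `B`. -/
lemma card_filter_mem_disjoint (k : ℕ) {S B : Finset V} (hSB : Disjoint S B) :
    #{A ∈ powersetCard k (univ : Finset V) | S ⊆ A ∧ Disjoint A B} =
      if #S ≤ k then (Fintype.card V - #B - #S).choose (k - #S) else 0 := by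
  split_ifs with hS
  · rw [Nat.sub_sub, ← card_union_of_disjoint hSB.symm, ← card_compl, ← card_powersetCard]
    refine card_nbij' (fun A => A \ S) (fun A => A ∪ S) ?_ ?_ ?_ ?_
    · intro A hA
      obtain ⟨h1, h2, h3⟩ := mem_filter.1 hA
      refine mem_powersetCard.2 ⟨fun a ha => ?_, ?_⟩
      · obtain ⟨haA, haS⟩ := mem_sdiff.1 ha
        simpa [haS] using disjoint_left.1 h3 haA
      · rw [card_sdiff_of_subset h2, (mem_powersetCard.1 h1).2]
    · intro A hA
      obtain ⟨h1, h2⟩ := mem_powersetCard.1 hA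
      have hd : ∀ a ∈ A, a ∉ B ∧ a ∉ S := fun a ha => by simpa using h1 ha
      refine mem_filter.2 ⟨mem_powersetCard.2 ⟨subset_univ _, ?_⟩, subset_union_right, ?_⟩
      · rw [card_union_of_disjoint (disjoint_left.2 fun a ha => (hd a ha).2), h2]
        omega
      · exact disjoint_union_left.2 ⟨disjoint_left.2 fun a ha => (hd a ha).1, hSB⟩
    · intro A hA
      exact sdiff_union_of_subset (mem_filter.1 hA).2.1
    · intro A hA
      obtain ⟨h1, h2⟩ := mem_powersetCard.1 hA
      have hd : Disjoint A S := disjoint_left.2 fun a ha haS => by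
        have := h1 ha
        simp [haS] at this
      exact union_sdiff_cancel_right hd
  · refine card_eq_zero.2 (filter_eq_empty_iff.2 fun A hA hSA => hS ?_)
    exact (mem_powersetCard.1 hA).2 ▸ card_le_card hSA.1

lemma card_disjoint_add_card_missing {F : Finset (Finset V)} {k : ℕ} (hk : 1 ≤ k)
    (hF : ∀ A ∈ F, A.card = k) {c : V} {B : Finset V} (hB : B ∈ F) (hc : c ∉ B) :
    #{A ∈ F | c ∈ A ∧ Disjoint A B} + #(missing F k c B) =
      (Fintype.card V - k - 1).choose (k - 1) := by
  have := card_filter_mem_disjoint k (S := {c}) (B := B) (disjoint_singleton_left.2 hc)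
  rw [card_singleton, if_pos hk, hF B hB] at this
  rw [← this, ← card_filter_add_card_filter_not
    (s := {A ∈ powersetCard k univ | {c} ⊆ A ∧ Disjoint A B}) (fun A => A ∈ F)]
  refine congrArg₂ (· + ·) (congrArg card ?_) (congrArg card ?_)
  · ext A
    simp only [mem_filter, mem_powersetCard, subset_univ, true_and, singleton_subset_iff]
    constructor
    · rintro ⟨h1, h2⟩
      exact ⟨⟨hF A h1, h2⟩, h1⟩
    · rintro ⟨⟨-, h2⟩, h1⟩
      exact ⟨h1, h2⟩
  · ext A
    simp only [missing, mem_filter, mem_powersetCard, subset_univ, true_and, singleton_subset_iff]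
    tauto

/-- The bound, once the members that avoid some point `c` are few. -/
lemma card_le_of_card_avoiding_le {F : Finset (Finset V)} {k : ℕ} (hk : 3 ≤ k)
    (hF : ∀ A ∈ F, A.card = k) (h : IsConditionallyIntersecting 3 (2 * k) F)
    (hn : 9 * (2 * k).choose k ≤ Fintype.card V) (hkn : 2 * k + 2 ≤ (2 * k).choose k) {c : V}
    (hne : ∃ B ∈ F, c ∉ B) (hcard : #{A ∈ F | c ∉ A} ≤ (2 * k).choose k) :
    #F ≤ (Fintype.card V - k - 1).choose (k - 1) + 1 := by
  set Q : Finset (Finset V) := {A ∈ F | c ∉ A}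
  have hQne : Q.Nonempty := by
    obtain ⟨B, hB, hcB⟩ := hne
    exact ⟨B, mem_filter.2 ⟨hB, hcB⟩⟩
  obtain ⟨B, hBQ, hmax⟩ := exists_max_image Q (fun B => #(missing F k c B)) hQne
  obtain ⟨hB, hcB⟩ := mem_filter.1 hBQ
  have h1 := two_mul_card_meeting_le hF h (by omega) hB hcB
  have h2 := card_disjoint_add_card_missing (by omega) hF hB hcB
  have hsplit : #F = #Q + (#{A ∈ F | c ∈ A ∧ Disjoint A B} +
      #{A ∈ F | c ∈ A ∧ ¬ Disjoint A B}) := by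
    rw [← card_filter_add_card_filter_not (s := F) (fun A => c ∈ A),
      ← card_filter_add_card_filter_not (s := {A ∈ F | c ∈ A}) (fun A => Disjoint A B),
      filter_filter, filter_filter, add_comm]
  by_cases hQ1 : #Q ≤ 1
  · omega
  obtain ⟨B', hB'Q, hBB'⟩ := exists_mem_ne (not_le.1 hQ1) B
  obtain ⟨hB', hcB'⟩ := mem_filter.1 hB'Q
  obtain ⟨v, hvB', hvB⟩ : ∃ v ∈ B', v ∉ B := by
    by_contra hcon
    push Not at hcon
    exact hBB' (eq_of_subset_of_card_le hcon (by rw [hF B hB, hF B' hB']))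
  have hcv : c ≠ v := fun e => hcB' (e ▸ hvB')
  have h3 := two_mul_card_meeting_le hF h (by omega) hB' hcB'
  have h4 := hmax B' hB'Q
  -- A k-set through c and v that avoids B is missing for B or is a member meeting B' in v. By the
  -- maximality of B, the second kind number at most half of the sets missing for B, so the latter
  -- outweigh Q.
  have h5 : (Fintype.card V - k - 2).choose (k - 2) ≤
      #(missing F k c B) + #{A ∈ F | c ∈ A ∧ ¬ Disjoint A B'} := by
    have hd : Disjoint ({c, v} : Finset V) B := by
      rw [disjoint_insert_left, disjoint_singleton_left]
      exact ⟨hcB, hvB⟩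
    have e := card_filter_mem_disjoint k hd
    rw [card_pair hcv, if_pos (by omega), hF B hB] at e
    rw [← e]
    refine le_trans (card_le_card fun A hA => ?_) (card_union_le _ _)
    obtain ⟨hAk, hAS, hAB⟩ := mem_filter.1 hA
    have hcA : c ∈ A := hAS (by simp)
    have hvA : v ∈ A := hAS (by simp)
    by_cases hAF : A ∈ F
    · refine mem_union_right _ (mem_filter.2 ⟨hAF, hcA, fun hd => ?_⟩)
      exact disjoint_left.1 hd hvA hvB'
    · exact mem_union_left _ (mem_filter.2 ⟨hAk, hcA, hAB, hAF⟩)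
  have h6 : Fintype.card V - 2 * k + 1 ≤ (Fintype.card V - k - 2).choose (k - 2) := by
    have := succ_le_choose_add (m := Fintype.card V - 2 * k) (t := k - 2) (by omega)
    rwa [show Fintype.card V - 2 * k + (k - 2) = Fintype.card V - k - 2 by omega] at this
  have hQle : #Q ≤ (2 * k).choose k := hcard
  omega

/-! ### Binomial estimates -/

lemma choose_add_le {a s b q : ℕ} (h : a + s ≤ b + 1) :
    (a + s).choose (q + 1) ≤ a.choose (q + 1) + s * b.choose q := by
  induction s with
  | zero => simp
  | succ s ih =>
    have h1 := ih (by omega)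
    have h2 : (a + s).choose q ≤ b.choose q := Nat.choose_le_choose _ (by omega)
    rw [← add_assoc, Nat.choose_succ_succ', Nat.succ_mul]
    omega

lemma le_choose_add (a s q : ℕ) :
    a.choose (q + 1) + s * a.choose q ≤ (a + s).choose (q + 1) := by
  induction s with
  | zero => simp
  | succ s ih =>
    have h2 : a.choose q ≤ (a + s).choose q := Nat.choose_le_choose _ (by omega)
    rw [← add_assoc, Nat.choose_succ_succ', Nat.succ_mul]
    omega

/-- The ratio C(a, q+1) / a is nondecreasing in a. -/
lemma mul_choose_le {a b : ℕ} (h : a ≤ b) (q : ℕ) :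
    b * a.choose (q + 1) ≤ a * b.choose (q + 1) := by
  rcases a with _ | a
  · simp
  obtain ⟨b, rfl⟩ : ∃ b', b = b' + 1 := ⟨b - 1, by omega⟩
  refine Nat.le_of_mul_le_mul_right (c := q + 1) ?_ (by omega)
  have h1 := Nat.add_one_mul_choose_eq a q
  have h2 := Nat.add_one_mul_choose_eq b q
  have h3 : a.choose q ≤ b.choose q := Nat.choose_le_choose _ (by omega)
  calc (b + 1) * (a + 1).choose (q + 1) * (q + 1)
      = (b + 1) * ((a + 1) * a.choose q) := by rw [h1, mul_assoc]
    _ ≤ (b + 1) * ((a + 1) * b.choose q) := by gcongr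
    _ = (a + 1) * ((b + 1) * b.choose q) := by ring
    _ = (a + 1) * (b + 1).choose (q + 1) * (q + 1) := by rw [h2, mul_assoc]

lemma succ_mul_choose_pred_le {r m : ℕ} (h : r ≤ m + 1) (q : ℕ) :
    (m + 1) * (r - 1).choose (q + 1) ≤ r * m.choose (q + 1) := by
  rcases r with _ | r
  · simp
  have h1 := mul_choose_le (show r ≤ m by omega) q
  have h2 : r.choose (q + 1) ≤ m.choose (q + 1) := Nat.choose_le_choose _ (by omega)
  rw [Nat.add_sub_cancel, Nat.succ_mul, Nat.succ_mul]
  omega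

lemma mul_choose_eq_mul_choose_pred (r q : ℕ) :
    r.choose (q + 1) * (q + 1) = r * (r - 1).choose q := by
  rcases r with _ | r
  · simp
  exact (Nat.add_one_mul_choose_eq r q).symm

lemma mul_four_pow_le_mul_centralBinom (j : ℕ) :
    60 * 4 ^ j ≤ (j + 3) * (j + 3).centralBinom := by
  induction j with
  | zero => decide
  | succ j ih =>
    have h := Nat.succ_mul_centralBinom_succ (j + 3)
    rw [show j + 1 + 3 = j + 3 + 1 by ring, h, pow_succ]
    nlinarith [Nat.zero_le (j + 3).centralBinom]

/-- The quartic exceeds both 10(j+2)³(j+1) and the cubic lower bound on m in `card_nondominated_le`,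
where k = j + 3. -/
lemma quartic_le_mul_four_pow (j : ℕ) :
    10 * j ^ 4 + 70 * j ^ 3 + 180 * j ^ 2 + 280 * j + 180 ≤ 180 * 4 ^ j := by
  induction j with
  | zero => simp
  | succ j ih =>
    rw [pow_succ 4 j, show 10 * (j + 1) ^ 4 + 70 * (j + 1) ^ 3 + 180 * (j + 1) ^ 2 + 280 * (j + 1) + 180 =
      10 * j ^ 4 + 110 * j ^ 3 + 450 * j ^ 2 + 890 * j + 720 by ring]
    omega

/-! ### Finding the center -/

/-- The point `c` that dominates most points dominates all but boundedly many. -/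
lemma exists_center {F : Finset (Finset V)} {m j : ℕ} (hV : Fintype.card V = m + 1)
    (hF : ∀ A ∈ F, A.card = j + 3) (h : IsConditionallyIntersecting 3 (2 * (j + 3)) F)
    (hm : 10 * (j + 2) ^ 3 * (j + 1) ≤ m) (hjm : j + 3 ≤ m)
    (hcard : (m - (j + 3)).choose (j + 2) ≤ #F) {y : V → Option V} (hy : IsDominator F y) :
    ∃ c, 2 * (m + 1) ≤ 2 * #{z | y z = some c} + 5 * ((j + 2) * (j + 4)) := by
  have : Nonempty V := Fintype.card_pos_iff.1 (by omega)
  obtain ⟨c, -, hmax⟩ := exists_max_image univ (fun c => #{z | y z = some c}) univ_nonempty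
  refine ⟨c, ?_⟩
  set r := #{z | y z = some c}
  set p := #{z | y z = none}
  have hcount := two_mul_card_le (by omega) hF h hy
  rw [hV, show j + 3 - 1 = j + 2 by omega, show j + 3 - 3 = j by omega,
    show m + 1 - 3 = m - 2 by omega] at hcount
  set S := ∑ c, (#{z | y z = some c}).choose (j + 2)
  change 2 * #F ≤ (m + 1).choose (j + 2) + 2 * (p * _) + S at hcount
  have hpr : p + r ≤ m + 1 := by
    rw [← hV, ← card_univ, ← card_union_of_disjoint]
    · exact card_le_card (subset_univ _)
    · refine disjoint_left.2 fun z hz hz' => ?_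
      have h1 := (mem_filter.1 hz).2
      rw [(mem_filter.1 hz').2] at h1
      exact Option.some_ne_none c h1
  have hsum : ∑ c, #{z | y z = some c} ≤ m + 1 := by
    rw [← hV, ← card_univ (α := V), ← card_biUnion]
    · exact card_le_card (subset_univ _)
    · intro a _ b _ hab
      refine disjoint_left.2 fun z hz hz' => hab ?_
      have h1 := (mem_filter.1 hz).2
      rw [(mem_filter.1 hz').2] at h1
      exact (Option.some_injective _ h1).symm
  have hS : (j + 2) * S ≤ (m + 1) * (r - 1).choose (j + 1) := by
    rw [mul_sum]
    refine le_trans ?_ (Nat.mul_le_mul_right _ hsum)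
    rw [sum_mul]
    refine sum_le_sum fun d _ => ?_
    rw [mul_comm, mul_choose_eq_mul_choose_pred]
    exact Nat.mul_le_mul_left _
      (Nat.choose_le_choose _ (Nat.sub_le_sub_right (hmax d (mem_univ d)) 1))
  have hX := succ_mul_choose_pred_le (show r ≤ m + 1 by omega) j
  have hK := Nat.add_one_mul_choose_eq m (j + 1)
  have hdiff : (m + 1).choose (j + 2) ≤ (m - (j + 3)).choose (j + 2) + (j + 4) * m.choose (j + 1) := by
    have := choose_add_le (a := m - (j + 3)) (s := j + 4) (b := m) (q := j + 1) (by omega)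
    rwa [show m - (j + 3) + (j + 4) = m + 1 by omega] at this
  have hT : m * (m - 2).choose j ≤ (j + 1) * m.choose (j + 1) := by
    have h1 := mul_choose_eq_mul_choose_pred m j
    have h2 : (m - 2).choose j ≤ (m - 1).choose j := Nat.choose_le_choose _ (by omega)
    calc m * (m - 2).choose j ≤ m * (m - 1).choose j := Nat.mul_le_mul_left _ h2
      _ = (j + 1) * m.choose (j + 1) := by rw [← h1, mul_comm]
  have hL : 0 < m.choose (j + 1) := Nat.choose_pos (by omega)
  set L := m.choose (j + 1)
  set t := (m - 2).choose j
  set K := (m + 1).choose (j + 2)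
  set C := (m - (j + 3)).choose (j + 2)
  rw [show j + 1 + 1 = j + 2 by ring] at hK
  change (m + 1) * L = K * (j + 2) at hK
  obtain ⟨w, hw⟩ : ∃ w, w + r = m + 1 := ⟨m + 1 - r, by omega⟩
  have hpw : p ≤ w := by omega
  have hmpos : 0 < m := by omega
  clear_value L t K C p S
  have e1 : w * L ≤ 2 * ((j + 2) * (j + 4)) * L + 2 * (j + 2) ^ 3 * (w * t) := by
    have g1 : p * ((j + 2) ^ 2 * t) ≤ w * ((j + 2) ^ 2 * t) := Nat.mul_le_mul_right _ hpw
    have g2 : 2 * K ≤ K + 2 * (w * ((j + 2) ^ 2 * t)) + S + 2 * ((j + 4) * L) := by omega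
    have g3 := Nat.mul_le_mul_left (j + 2) g2
    have g4 : (w + r) * L = (j + 2) * K := by rw [hw, hK, mul_comm]
    have g5 : (j + 2) * S ≤ r * L := hS.trans hX
    linarith
  have e2 : m * (w * L) ≤ 2 * ((j + 2) * (j + 4)) * (m * L) +
      2 * (j + 2) ^ 3 * (j + 1) * (w * L) := by
    have g1 := Nat.mul_le_mul_left m e1
    have g2 := Nat.mul_le_mul_left (2 * (j + 2) ^ 3 * w) hT
    linarith
  -- The lower bound on m absorbs the last term of `e2` into a fifth of m * (w * L), whence the
  -- factor 5/2 in the conclusion.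
  have e3 := Nat.mul_le_mul_right (w * L) hm
  have e4 : m * L * (4 * w) ≤ m * L * (10 * ((j + 2) * (j + 4))) := by linarith
  have e5 := Nat.le_of_mul_le_mul_left e4 (Nat.mul_pos hmpos hL)
  omega

/-- Here v = w - k. Relative to L, both b and t are O(1/m) for fixed k, and E is close to L; so
`hcount'` amounts to v ≤ 1 + O(1/m), against v ≥ k + 1. -/
lemma not_lt_of_nondominated_counts {m j w v L t E b b₁ b₂ : ℕ}
    (hm : 9 * j ^ 3 + 68 * j ^ 2 + 194 * j + 166 ≤ m) (hL : 0 < L) (hv : w = v + (j + 3))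
    (hjv : j + 4 ≤ v) (hw : 2 * (w + 1) ≤ 5 * ((j + 2) * (j + 4))) (hL1 : L ≤ E + w * t)
    (hL2 : m * t = (j + 1) * L) (hB1 : b * (j + 3) = w * b₁) (hB2 : b₁ * (j + 2) = (w - 1) * b₂)
    (hB3 : m * b₂ ≤ (w - 2) * L) (hcount' : v * E ≤ b + L + w * ((j + 2) ^ 2 * t)) : False := by
  have hb : m * b ≤ 3 * (w - 2) * w * L := by
    have g : w - 1 ≤ 3 * ((j + 2) * (j + 3)) := by
      have : 2 * (w + 1) ≤ 5 * ((j + 2) * (j + 4)) := by omega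
      have : 2 * w ≤ 6 * ((j + 2) * (j + 3)) + 2 := by nlinarith only [this]
      omega
    have hpos : 0 < (j + 2) * (j + 3) := by positivity
    refine Nat.le_of_mul_le_mul_right ?_ hpos
    calc m * b * ((j + 2) * (j + 3)) = m * (j + 2) * (b * (j + 3)) := by ring
      _ = w * m * (b₁ * (j + 2)) := by rw [hB1]; ring
      _ = w * (w - 1) * (m * b₂) := by rw [hB2]; ring
      _ ≤ w * (3 * ((j + 2) * (j + 3))) * ((w - 2) * L) := by gcongr
      _ = _ := by ring
  have hE : m * L ≤ m * E + w * ((j + 1) * L) := by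
    calc m * L ≤ m * (E + w * t) := Nat.mul_le_mul_left _ hL1
      _ = m * E + w * (m * t) := by ring
      _ = _ := by rw [hL2]
  have key : v * (m * L) ≤ 3 * (w - 2) * w * L + m * L + w * ((j + 2) ^ 2 * ((j + 1) * L)) +
      v * (w * ((j + 1) * L)) := by
    have g1 := Nat.mul_le_mul_left v hE
    have g2 := Nat.mul_le_mul_left m hcount'
    have g3 : m * (b + L + w * ((j + 2) ^ 2 * t)) =
        m * b + m * L + w * ((j + 2) ^ 2 * (m * t)) := by ring
    rw [g3, hL2] at g2
    linarith
  have key2 : v * m ≤ 3 * (w - 2) * w + m + w * ((j + 2) ^ 2 * (j + 1)) + v * (w * (j + 1)) := by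
    refine Nat.le_of_mul_le_mul_right ?_ hL
    linarith
  have h3 : 3 * w ≤ 7 * (v - 1) := by omega
  have key3 : w * (3 * m) ≤ w * (7 * (3 * (w - 2) + (j + 2) ^ 2 * (j + 1) + v * (j + 1))) := by
    obtain ⟨u, hu⟩ : ∃ u, v = u + 1 := ⟨v - 1, by omega⟩
    have g1 : 3 * w ≤ 7 * u := by omega
    have g2 : u * m ≤ 3 * (w - 2) * w + w * ((j + 2) ^ 2 * (j + 1)) + v * (w * (j + 1)) := by
      have : v * m = u * m + m := by rw [hu]; ring
      omega
    calc w * (3 * m) = 3 * w * m := by ring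
      _ ≤ 7 * u * m := by gcongr
      _ = 7 * (u * m) := by ring
      _ ≤ 7 * (3 * (w - 2) * w + w * ((j + 2) ^ 2 * (j + 1)) + v * (w * (j + 1))) := by gcongr
      _ = _ := by ring
  have key4 := Nat.le_of_mul_le_mul_left key3 (by omega)
  have hw2 : 2 * (w + 1) ≤ 5 * ((j + 2) * (j + 4)) := by omega
  have hw3 : 2 * (w - 2) + 6 ≤ 5 * ((j + 2) * (j + 4)) := by omega
  have hv2 : 2 * (v + j + 4) ≤ 5 * ((j + 2) * (j + 4)) := by omega
  have hv3 := Nat.mul_le_mul_right (j + 1) hv2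
  nlinarith only [key4, hw3, hv3, hm]

/-- Few points are neither the center nor dominated by it. -/
lemma card_nondominated_le {F : Finset (Finset V)} {m j : ℕ} (hV : Fintype.card V = m + 1)
    (hF : ∀ A ∈ F, A.card = j + 3) (h : IsConditionallyIntersecting 3 (2 * (j + 3)) F)
    (hm : 9 * j ^ 3 + 68 * j ^ 2 + 194 * j + 166 ≤ m)
    (hcard : (m - (j + 3)).choose (j + 2) ≤ #F) {y : V → Option V} (hy : IsDominator F y)
    {c : V} (hc : 2 * (m + 1) ≤ 2 * #{z | y z = some c} + 5 * ((j + 2) * (j + 4)))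
    {W : Finset V} (hW : ∀ z, z ∈ W ↔ z ≠ c ∧ y z ≠ some c) :
    #W ≤ 2 * (j + 3) := by
  by_contra! hw
  have hcount := card_le_of_isDominator (by omega) hF h hy c W hW
  rw [hV, show j + 3 - 1 = j + 2 by omega, show j + 3 - 3 = j by omega,
    show m + 1 - 3 = m - 2 by omega, show j + 3 - 2 = j + 1 by omega,
    Nat.add_sub_cancel] at hcount
  set r := #{z | y z = some c}
  set w := #W
  have hwr : w + r = m := by
    have hd : Disjoint W ({z | y z = some c} : Finset V) := disjoint_left.2 fun z hz hz' =>
      ((hW z).1 hz).2 (mem_filter.1 hz').2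
    have hu : W ∪ ({z | y z = some c} : Finset V) = univ.erase c := by
      ext z
      have : y z = some c → z ≠ c := fun e => (hy.dominates z c e).1.symm
      simp only [mem_union, hW, mem_filter, mem_univ, true_and, mem_erase, and_true]
      tauto
    rw [← card_union_of_disjoint hd, hu, card_erase_of_mem (mem_univ c), card_univ, hV,
      Nat.add_sub_cancel]
  -- The term C(r, k-1) also occurs in the upper bound for |F| and cancels, leaving `hcount'`.
  have hlow : r.choose (j + 2) + (w - (j + 3)) * r.choose (j + 1) ≤
      (m - (j + 3)).choose (j + 2) := by
    have := le_choose_add r (w - (j + 3)) (j + 1)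
    rwa [show r + (w - (j + 3)) = m - (j + 3) by omega] at this
  have hL1 : m.choose (j + 1) ≤ r.choose (j + 1) + w * (m - 1).choose j := by
    have := choose_add_le (a := r) (s := w) (b := m - 1) (q := j) (by omega)
    rwa [show r + w = m by omega] at this
  have hL2 : m * (m - 1).choose j = (j + 1) * m.choose (j + 1) := by
    rw [← mul_choose_eq_mul_choose_pred m j, mul_comm]
  have hT : (m - 2).choose j ≤ (m - 1).choose j := Nat.choose_le_choose _ (by omega)
  have hB1 : w.choose (j + 3) * (j + 3) = w * (w - 1).choose (j + 2) :=
    mul_choose_eq_mul_choose_pred w (j + 2)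
  have hB2 : (w - 1).choose (j + 2) * (j + 2) = (w - 1) * (w - 2).choose (j + 1) :=
    mul_choose_eq_mul_choose_pred (w - 1) (j + 1)
  have hB3 := mul_choose_le (show w - 2 ≤ m by omega) j
  have hL : 0 < m.choose (j + 1) := Nat.choose_pos (by nlinarith [sq_nonneg j])
  obtain ⟨v, hv⟩ : ∃ v, w = v + (j + 3) := ⟨w - (j + 3), by omega⟩
  have hT' := Nat.mul_le_mul_left w (Nat.mul_le_mul_left ((j + 2) ^ 2) hT)
  exact not_lt_of_nondominated_counts hm hL hv (by omega) (by omega) hL1 hL2 hB1 hB2 hB3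
    (by rw [← show w - (j + 3) = v by omega]; omega)

/-! ### Conclusion -/

/-- A non-intersecting conditionally intersecting family is small. -/
theorem card_le_of_not_intersecting {k : ℕ} (hk : 3 ≤ k)
    (hn : 3 * k * (2 * k).choose k ≤ Fintype.card V) {F : Finset (Finset V)}
    (hF : ∀ A ∈ F, A.card = k) (hcond : IsConditionallyIntersecting 3 (2 * k) F)
    (hnot : ¬ (F : Set (Finset V)).Intersecting) :
    #F ≤ (Fintype.card V - k - 1).choose (k - 1) + 1 := by
  by_contra! hcard
  obtain ⟨j, rfl⟩ : ∃ j, k = j + 3 := ⟨k - 3, by omega⟩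
  have hn1 : 180 * 4 ^ j ≤ Fintype.card V := by
    have := mul_four_pow_le_mul_centralBinom j
    rw [Nat.centralBinom] at this
    nlinarith
  have hq := quartic_le_mul_four_pow j
  have hn9 : 9 * (2 * (j + 3)).choose (j + 3) ≤ Fintype.card V :=
    (Nat.mul_le_mul_right _ (by omega)).trans hn
  obtain ⟨m, hV⟩ : ∃ m, Fintype.card V = m + 1 := ⟨Fintype.card V - 1, by omega⟩
  have hcard' : (m - (j + 3)).choose (j + 2) ≤ #F := by
    rw [hV, show m + 1 - (j + 3) - 1 = m - (j + 3) by omega,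
      show j + 3 - 1 = j + 2 by omega] at hcard
    omega
  obtain ⟨y, hy⟩ := exists_isDominator F
  obtain ⟨c, hc⟩ := exists_center hV hF hcond
    (by nlinarith only [hn1, hq, hV]) (by nlinarith only [hn1, hq, hV]) hcard' hy
  have hW := card_nondominated_le hV hF hcond
    (by nlinarith only [hn1, hq, hV, Nat.zero_le (j ^ 3), Nat.zero_le (j ^ 4)]) hcard' hy hc
    (W := {z | z ≠ c ∧ y z ≠ some c}) (fun z => by simp)
  have hne : ∃ B ∈ F, c ∉ B := by
    by_contra! hall
    exact hnot fun A hA B hB hAB => disjoint_left.1 hAB (hall A hA) (hall B hB)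
  have hfew : #{A ∈ F | c ∉ A} ≤ (2 * (j + 3)).choose (j + 3) := by
    refine le_trans ?_ (Nat.choose_le_choose (j + 3) hW)
    rw [← card_powersetCard]
    refine card_le_card fun A hA => ?_
    obtain ⟨hAF, hcA⟩ := mem_filter.1 hA
    refine mem_powersetCard.2 ⟨fun z hz => ?_, hF A hAF⟩
    exact mem_filter.2 ⟨mem_univ z, fun e => hcA (e ▸ hz),
      fun e => hcA ((hy.dominates z c e).2 A hAF hz)⟩
  have hbinom : 2 * (j + 3) + 2 ≤ (2 * (j + 3)).choose (j + 3) := by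
    have h1 := Nat.choose_le_centralBinom 2 (j + 3)
    rw [Nat.centralBinom] at h1
    refine le_trans ?_ h1
    rw [Nat.choose_two_right, Nat.le_div_iff_mul_le (by norm_num),
      show 2 * (j + 3) - 1 = 2 * j + 5 by omega]
    nlinarith
  exact absurd (card_le_of_card_avoiding_le hk hF hcond hn9 hbinom hne hfew) (not_le.2 hcard)

end ConditionallyIntersecting

theorem mainTheorem5 (k n : ℕ) (hk : 3 ≤ k) (hn : 3 * k * (2 * k).choose k ≤ n)
    (F : Finset (Finset (Fin n))) (hF : ∀ A ∈ F, A.card = k)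
    (hcond : IsConditionallyIntersecting 3 (2 * k) F)
    (hnot : ¬ (F : Set (Finset (Fin n))).Intersecting) :
    F.card ≤ (n - k - 1).choose (k - 1) + 1 := by
  have := ConditionallyIntersecting.card_le_of_not_intersecting hk (by simpa using hn) hF hcond hnot
  simpa using this
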